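/- Let $V$ be a finite non-empty set of $n$ players and let $\alpha$ be a positive real number (the link price). A strategy of a player $u \in V$ is a subset $s_u \subseteq V \setminus \{u\}$ (the players to which $u$ buys a link). A strategy vector $s = (s_u)_{u \in V}$ determines the undirected communication network $G_s$ with vertex set $V$, in which $u$ and $v$ are adjacent if and only if $v \in s_u$ or $u \in s_v$. The cost of player $u$ is $$c_u(s) = \alpha |s_u| + \sum_{v \neq u} d_{G_s}(u,v),$$ where $d_{G_s}(u,v)$ is the distance between $u$ and $v$ in $G_s$ ($+\infty$ if they lie in different connected components). A strategy vector $s$ is a Nash equilibrium if $c_u(s) \le c_u(s')$ for every player $u$ and every strategy vector $s'$ that differs from $s$ at most in the strategy of $u$. Theorem. If $\alpha > 17n$, then for every Nash equilibrium $s$ the network $G_s$ is a tree. -/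

import Mathlib

open scoped ENNReal

namespace NetworkCreation

/-- A strategy of player `u`: a set of other players to which `u` buys a link. -/
abbrev Strategy (V : Type*) (u : V) : Type _ := {A : Finset V // u ∉ A}

/-- A strategy vector: one strategy for each player. -/
abbrev StrategyVector (V : Type*) : Type _ := ∀ u : V, Strategy V u

/-- The (undirected) communication network of a strategy vector: `u` and `v` are adjacent iff
at least one of them buys the link to the other. -/
def network {V : Type*} (s : StrategyVector V) : SimpleGraph V where
  Adj u v := v ∈ (s u).1 ∨ u ∈ (s v).1
  symm := ⟨fun _ _ h => h.symm⟩
  loopless := ⟨fun u h => h.elim (s u).2 (s u).2⟩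

/-- The cost of player `u` for the link price `α > 0`: `α` times the number of links that `u`
buys plus the sum of the distances from `u` to all other players. The distance between two
players in different connected components is `∞`. -/
noncomputable def cost {V : Type*} [Fintype V] [DecidableEq V] (α : ℝ)
    (s : StrategyVector V) (u : V) : ℝ≥0∞ :=
  ENNReal.ofReal α * ((s u).1.card : ℝ≥0∞) +
    ∑ v ∈ Finset.univ.erase u, (((network s).edist u v : ℕ∞) : ℝ≥0∞)

/-- A Nash equilibrium: no player can decrease its own cost by changing only its own strategy. -/
def IsNashEquilibrium {V : Type*} [Fintype V] [DecidableEq V] (α : ℝ)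
    (s : StrategyVector V) : Prop :=
  ∀ (u : V) (s' : StrategyVector V), (∀ v, v ≠ u → s' v = s v) → cost α s u ≤ cost α s' u

end NetworkCreation

/-!
In an equilibrium the network is connected, since buying all links has a finite cost. Suppose that
it has a cycle. Let `r` be a player with the least sum `D(r)` of distances, and fix a breadth-first
search tree with root `r`. Two facts about the links on cycles contradict each other.

*They are few.* A player `u` can replace two links by one link to `r`. It saves `α`, and its new
distances exceed those of `r` by at most `17`, provided that the lost neighbours are still reached
soon from `r`. As `D(r)` is minimal and `α > 17n`, this must not happen. So every player
buys at most one link that does not lead to one of its children (`eq_of_parent_ne`). Let `X` be the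
set of the buyers of links outside the tree. The eight tree edges above a member of `X` are bought
by the parents (`chain`), and the paths above distinct members of `X` are disjoint
(`eq_of_iterate_eq`). The links on cycles consist of a forest and at most `|X|` further links
(`card_edgeFinset_lt`), so that the sum of `deg v - 2` over the players `v` on cycles, where only
links on cycles count, is less than `2|X|`.

*They are many.* There are no three consecutive players of degree two on a directed path
`v₀ → v₁ → v₂ → v₃` (`not_three_consecutive`). To see this, cut out the players that `v₀` reaches
through `v₃`; a second link on the boundary of this set gives a player `q` far from `v₀` who could
replace its link by one to `v₀` (`exists_far_buyer`), while `v₂` could replace its link by one to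
`q`. These two deviations bound `D(v₂)` by `D(v₀) + 2n` from above, with a large gain for the
players that hang at `v₁` and `v₂` by bridges. The deviations in which `v₀`, `v₁`, `v₂` move their
links one step further bound the number of the players beyond `v₁`, `v₂`, `v₃` by the number of
those that hang there. These bounds are incompatible. Hence the path above a member of `X` contains
two players of degree at least three (`two_mul_card_le`), and the sum of `deg v - 2` is at least
`2|X|`.
-/

namespace NetworkCreation

open SimpleGraph

section

variable {V : Type*}

/-! ### Distances -/

lemma edist_le_add {K : SimpleGraph V} {u p z : V} {m k : ℕ} (h : K.edist u p ≤ m)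
    (h' : K.edist p z ≤ k) : K.edist u z ≤ ((m + k : ℕ) : ℕ∞) := by
  push_cast
  exact SimpleGraph.edist_triangle.trans (add_le_add h h')

lemma edist_le_one {K : SimpleGraph V} {p z : V} (a : K.Adj p z) : K.edist p z ≤ (1 : ℕ) := by
  simp [edist_eq_one_iff_adj.2 a]

lemma edist_le_add_one {K : SimpleGraph V} {u p z : V} {m : ℕ} (h : K.edist u p ≤ m)
    (a : K.Adj p z) : K.edist u z ≤ ((m + 1 : ℕ) : ℕ∞) :=
  edist_le_add h (edist_le_one a)

lemma dist_le_dist_add_one {G : SimpleGraph V} (hc : G.Connected) {p q : V} (w : V)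
    (a : G.Adj p q) : G.dist w q ≤ G.dist w p + 1 := by
  have := hc.dist_triangle (u := w) (v := p) (w := q)
  rwa [dist_eq_one_iff_adj.2 a] at this

/-- The last step of a shortest path from `w` to `z`. -/
lemma exists_adj_dist_add_one_eq {G : SimpleGraph V} (hc : G.Connected) {w z : V} (h : w ≠ z) :
    ∃ p, G.Adj p z ∧ G.dist w p + 1 = G.dist w z := by
  obtain ⟨W, hW⟩ := hc.exists_walk_length_eq_dist z w
  cases W with
  | nil => exact absurd rfl h
  | @cons _ p _ a W' =>
    refine ⟨p, a.symm, le_antisymm ?_ (dist_le_dist_add_one hc w a.symm)⟩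
    rw [dist_comm (u := w) (v := z), ← hW, dist_comm, Walk.length_cons]
    exact Nat.add_le_add_right (dist_le _) 1

/-- The sum of the distances from `u` to all players. -/
noncomputable def distSum [Fintype V] (G : SimpleGraph V) (u : V) : ℕ := ∑ z, G.dist u z

/-! ### Deviations of one player -/

/-- The network `G` without the links between `u` and the members of `B`. -/
def dropLinks (G : SimpleGraph V) (u : V) (B : Finset V) : SimpleGraph V where
  Adj p q := G.Adj p q ∧ ¬(p = u ∧ q ∈ B) ∧ ¬(q = u ∧ p ∈ B)
  symm := ⟨fun _ _ h => ⟨h.1.symm, h.2.2, h.2.1⟩⟩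
  loopless := ⟨fun _ h => G.loopless.irrefl _ h.1⟩

/-- The network `G` after `u` has exchanged its links to `B` for a link to `w`. -/
def swapLinks (G : SimpleGraph V) (u : V) (B : Finset V) (w : V) : SimpleGraph V :=
  dropLinks G u B ⊔ edge u w

lemma swapLinks_adj_of_ne {G : SimpleGraph V} {u w p q : V} {B : Finset V} (a : G.Adj p q)
    (hp : p ≠ u) (hq : q ≠ u) : (swapLinks G u B w).Adj p q :=
  Or.inl ⟨a, fun h => hp h.1, fun h => hq h.1⟩

lemma swapLinks_adj_new {G : SimpleGraph V} {u w : V} {B : Finset V} (h : w ≠ u) :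
    (swapLinks G u B w).Adj u w :=
  Or.inr ((edge_adj _ _ _ _).2 ⟨Or.inl ⟨rfl, rfl⟩, h.symm⟩)

lemma swapLinks_adj_of_notMem {G : SimpleGraph V} {u w q : V} {B : Finset V} (a : G.Adj u q)
    (hq : q ∉ B) : (swapLinks G u B w).Adj u q :=
  Or.inl ⟨a, fun h => hq h.2, fun h => a.ne h.1.symm⟩

variable [Fintype V] [DecidableEq V]

lemma IsNashEquilibrium.connected [Nonempty V] {α : ℝ} {s : StrategyVector V}
    (hs : IsNashEquilibrium α s) : (network s).Connected := by
  refine connected_iff _ |>.2 ⟨fun u v => ?_, inferInstance⟩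
  by_cases huv : u = v
  · exact huv ▸ Reachable.refl u
  -- Buying a link to everybody has a finite cost.
  let s' : StrategyVector V := Function.update s u ⟨Finset.univ.erase u, by simp⟩
  have h := hs u s' (fun v hv => Function.update_of_ne hv _ _)
  have hfin : cost α s' u < ⊤ := by
    refine ENNReal.add_lt_top.2 ⟨ENNReal.mul_lt_top ENNReal.ofReal_lt_top
      (ENNReal.natCast_lt_top _), ENNReal.sum_lt_top.2 fun z hz => ?_⟩
    have a : (network s').Adj u z := by
      left
      simpa [s'] using hz
    rw [edist_eq_one_iff_adj.2 a]
    simp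
  have := (ENNReal.add_lt_top.1 (h.trans_lt hfin)).2
  have := ENNReal.sum_lt_top.1 this v (by simp [Ne.symm huv])
  refine reachable_of_edist_ne_top fun h => ?_
  simp [h] at this

/-- The equilibrium condition for one deviation: if the new strategy `A` of `u` brings `u` within
distance `f z` of every player `z`, then it is not cheaper than the old one, measured by `f`. -/
lemma IsNashEquilibrium.cost_le [Nonempty V] {α : ℝ} (hα : 0 ≤ α) {s : StrategyVector V}
    (hs : IsNashEquilibrium α s) (u : V) (A : Finset V) (hA : u ∉ A) (f : V → ℕ)
    (hf : ∀ z, (network (Function.update s u ⟨A, hA⟩)).edist u z ≤ f z) :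
    α * (s u).1.card + distSum (network s) u ≤ α * A.card + ∑ z, (f z : ℝ) := by
  have hc := hs.connected
  have h := hs u (Function.update s u ⟨A, hA⟩) (fun v hv => Function.update_of_ne hv _ _)
  have h1 : cost α s u
      = ENNReal.ofReal (α * (s u).1.card + distSum (network s) u) := by
    rw [ENNReal.ofReal_add (by positivity) (by positivity), ENNReal.ofReal_mul hα, cost]
    congr 1
    · simp
    · rw [distSum, ENNReal.ofReal_natCast, ← Finset.add_sum_erase _ _ (Finset.mem_univ u)]
      simp only [dist_self, zero_add, Nat.cast_sum]
      refine Finset.sum_congr rfl fun z _ => ?_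
      rw [← (hc.preconnected u z).coe_dist_eq_edist]
      simp
  have h2 : cost α (Function.update s u ⟨A, hA⟩) u
      ≤ ENNReal.ofReal (α * A.card + ∑ z, (f z : ℝ)) := by
    rw [ENNReal.ofReal_add (by positivity) (by positivity), ENNReal.ofReal_mul hα, cost]
    refine add_le_add (by simp) ?_
    rw [← Nat.cast_sum, ENNReal.ofReal_natCast, Nat.cast_sum]
    refine (Finset.sum_le_sum_of_subset (Finset.subset_univ _)).trans
      (Finset.sum_le_sum fun z _ => ?_)
    have := ENat.toENNReal_le.2 (hf z)
    simpa using this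
  rw [h1] at h
  exact (ENNReal.ofReal_le_ofReal_iff (by positivity)).1 (h.trans h2)

/-- `u` drops its links to `B` and buys one link to `w`. -/
lemma IsNashEquilibrium.swap_le [Nonempty V] {α : ℝ} (hα : 0 ≤ α) {s : StrategyVector V}
    (hs : IsNashEquilibrium α s) {u w : V} {B : Finset V} (hB : B ⊆ (s u).1) (hw : w ≠ u)
    (f : V → ℕ) (hf : ∀ z, (swapLinks (network s) u B w).edist u z ≤ f z) :
    α * B.card + distSum (network s) u ≤ α + ∑ z, (f z : ℝ) := by
  have hA : u ∉ insert w ((s u).1 \ B) := by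
    simp [hw.symm, (s u).2]
  have h := hs.cost_le hα u (insert w ((s u).1 \ B)) hA f fun z => by
    refine (edist_anti ?_).trans (hf z)
    rw [SimpleGraph.le_iff_adj]
    rintro p q (⟨a, h1, h2⟩ | a)
    · rcases a with a | a
      · by_cases hp : p = u
        · subst hp
          left
          simp only [Function.update_self, Finset.mem_insert, Finset.mem_sdiff]
          exact Or.inr ⟨a, fun h => h1 ⟨rfl, h⟩⟩
        · left
          rwa [Function.update_of_ne hp]
      · by_cases hq : q = u
        · subst hq
          right
          simp only [Function.update_self, Finset.mem_insert, Finset.mem_sdiff]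
          exact Or.inr ⟨a, fun h => h2 ⟨rfl, h⟩⟩
        · right
          rwa [Function.update_of_ne hq]
    · rcases ((edge_adj _ _ _ _).1 a).1 with ⟨rfl, rfl⟩ | ⟨rfl, rfl⟩
      · left; simp
      · right; simp
  have h3 : (insert w ((s u).1 \ B)).card + B.card ≤ (s u).1.card + 1 := by
    have := Finset.card_insert_le w ((s u).1 \ B)
    have := Finset.card_sdiff_add_card_eq_card hB
    omega
  have h4 : α * ((insert w ((s u).1 \ B)).card + B.card) ≤ α * ((s u).1.card + 1) :=
    mul_le_mul_of_nonneg_left (by exact_mod_cast h3) hα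
  linarith

/-- `u` drops its link to `b`. -/
lemma IsNashEquilibrium.drop_le [Nonempty V] {α : ℝ} (hα : 0 ≤ α) {s : StrategyVector V}
    (hs : IsNashEquilibrium α s) {u b : V} (hb : b ∈ (s u).1)
    (f : V → ℕ) (hf : ∀ z, (dropLinks (network s) u {b}).edist u z ≤ f z) :
    α + distSum (network s) u ≤ ∑ z, (f z : ℝ) := by
  have hA : u ∉ (s u).1.erase b := by
    simp [(s u).2]
  have h := hs.cost_le hα u ((s u).1.erase b) hA f fun z => by
    refine (edist_anti ?_).trans (hf z)
    rw [SimpleGraph.le_iff_adj]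
    rintro p q ⟨a, h1, h2⟩
    rw [Finset.mem_singleton] at h1 h2
    rcases a with a | a
    · by_cases hp : p = u
      · subst hp
        left
        simp only [Function.update_self, Finset.mem_erase]
        exact ⟨fun h => h1 ⟨rfl, h⟩, a⟩
      · left
        rwa [Function.update_of_ne hp]
    · by_cases hq : q = u
      · subst hq
        right
        simp only [Function.update_self, Finset.mem_erase]
        exact ⟨fun h => h2 ⟨rfl, h⟩, a⟩
      · right
        rwa [Function.update_of_ne hq]
  have h3 : ((s u).1.card : ℝ) = ((s u).1.erase b).card + 1 := by
    exact_mod_cast (Finset.card_erase_add_one hb).symm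
  rw [h3] at h
  linarith

/-- `b` is `w`, or it is reached from `w` on a shortest path that does not end with a link
from `u`. -/
def ReachedBeside (G : SimpleGraph V) (w u b : V) : Prop :=
  b = w ∨ ∃ p, p ≠ u ∧ G.Adj p b ∧ G.dist w p + 1 = G.dist w b

omit [Fintype V] [DecidableEq V] in
lemma reachedBeside_of_dist_le {G : SimpleGraph V} (hc : G.Connected) {w u b : V}
    (h : G.dist w b ≤ G.dist w u) : ReachedBeside G w u b := by
  by_cases hb : b = w
  · exact Or.inl hb
  obtain ⟨p, a, hp⟩ := exists_adj_dist_add_one_eq hc (Ne.symm hb)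
  exact Or.inr ⟨p, by rintro rfl; omega, a, hp⟩

omit [Fintype V] [DecidableEq V] in
/-- After `u` has exchanged its links to `B` for a link to `w`, it reaches everybody by way of `w`
with a delay of at most `K`, as soon as this holds for those members of `B` that shortest paths
from `w` reach only through `u`. -/
lemma swapLinks_edist_le {G : SimpleGraph V} (hc : G.Connected) {u w : V} (hw : w ≠ u)
    {B : Finset V} {K : ℕ}
    (hB : ∀ b ∈ B, ReachedBeside G w u b ∨
      (swapLinks G u B w).edist u b ≤ ((1 + G.dist w b + K : ℕ) : ℕ∞)) (z : V) :
    (swapLinks G u B w).edist u z ≤ ((1 + G.dist w z + K : ℕ) : ℕ∞) := by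
  obtain ⟨m, hm⟩ : ∃ m, G.dist w z = m := ⟨_, rfl⟩
  induction m using Nat.strong_induction_on generalizing z with
  | _ m ih =>
    by_cases hzu : z = u
    · subst hzu; simp
    by_cases hzw : z = w
    · subst hzw
      exact (edist_le_one (swapLinks_adj_new hw)).trans (Nat.cast_le.2 (by omega))
    have key : ∀ p, p ≠ u → G.Adj p z → G.dist w p + 1 = G.dist w z →
        (swapLinks G u B w).edist u z ≤ ((1 + G.dist w z + K : ℕ) : ℕ∞) := fun p hpu a hp =>
      (edist_le_add_one (ih _ (by omega) p rfl) (swapLinks_adj_of_ne a hpu hzu)).trans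
        (Nat.cast_le.2 (by omega))
    by_cases hz : z ∈ B
    · obtain (h | ⟨p, hpu, a, hp⟩) | h := hB z hz
      · exact absurd h hzw
      · exact key p hpu a hp
      · exact h
    obtain ⟨p, a, hp⟩ := exists_adj_dist_add_one_eq hc (Ne.symm hzw)
    by_cases hpu : p = u
    · subst hpu
      exact (edist_le_one (swapLinks_adj_of_notMem a hz)).trans (Nat.cast_le.2 (by omega))
    · exact key p hpu a hp

/-- If `u` buys a link to `b` whose loss can be compensated by a detour of length at most `L`,
then the detour is long. -/
lemma IsNashEquilibrium.le_of_detour [Nonempty V] {α : ℝ} (hα : 0 ≤ α) {s : StrategyVector V}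
    (hs : IsNashEquilibrium α s) {u b : V} (hb : b ∈ (s u).1) {L : ℕ}
    (hL : (dropLinks (network s) u {b}).edist u b ≤ ((L + 1 : ℕ) : ℕ∞)) :
    α ≤ L * Fintype.card V := by
  have hc := hs.connected
  have h := hs.drop_le hα hb (fun z => (network s).dist u z + L) fun z => by
    obtain ⟨m, hm⟩ : ∃ m, (network s).dist u z = m := ⟨_, rfl⟩
    induction m using Nat.strong_induction_on generalizing z with
    | _ m ih =>
      have hub : (network s).dist u b = 1 := dist_eq_one_iff_adj.2 (Or.inl hb)
      by_cases hzu : z = u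
      · subst hzu; simp
      by_cases hzb : z = b
      · subst hzb
        exact hL.trans (Nat.cast_le.2 (by omega))
      obtain ⟨p, a, hp⟩ := exists_adj_dist_add_one_eq hc (Ne.symm hzu)
      by_cases hpu : p = u
      · subst hpu
        refine (edist_le_one (K := dropLinks (network s) p {b}) ?_).trans
          (Nat.cast_le.2 (by omega))
        exact ⟨a, by simp [hzb], fun h => hzu h.1⟩
      · refine (edist_le_add_one (ih _ (by omega) p rfl) ?_).trans (Nat.cast_le.2 (by omega))
        exact ⟨a, fun h => hpu h.1, fun h => hzu h.1⟩
  have h2 : ∑ z, (((network s).dist u z + L : ℕ) : ℝ)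
      = distSum (network s) u + L * Fintype.card V := by
    simp [distSum, Finset.sum_add_distrib, mul_comm]
  rw [h2] at h
  linarith

end

section

variable {V : Type*}

/-! ### Bridges at a player with two links on cycles -/

/-- A shortest path from `p` to `z` avoids `v`, hence the link `vb`, if `v` is not closer to `z`
than `p`. -/
lemma reachable_deleteEdges_of_dist_le {G : SimpleGraph V} (hc : G.Connected) {v p z : V} (b : V)
    (hp : p ≠ v) (h : G.dist p z ≤ G.dist v z) : (G.deleteEdges {s(v, b)}).Reachable p z := by
  obtain ⟨m, hm⟩ : ∃ m, G.dist p z = m := ⟨_, rfl⟩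
  induction m using Nat.strong_induction_on generalizing p with
  | _ m ih =>
    by_cases hpz : p = z
    · exact hpz ▸ Reachable.refl p
    obtain ⟨x, a, hx⟩ := exists_adj_dist_add_one_eq hc (Ne.symm hpz)
    rw [dist_comm, dist_comm (u := z)] at hx
    have hxv : x ≠ v := by rintro rfl; omega
    refine Reachable.trans (Adj.reachable ?_) (ih _ (by omega) hxv (by omega) rfl)
    rw [deleteEdges_adj]
    refine ⟨a.symm, ?_⟩
    simp only [Set.mem_singleton_iff, Sym2.eq_iff]
    rintro (⟨h, -⟩ | ⟨-, h⟩)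
    exacts [hp h, hxv h]

/-- The two sides of a bridge `vb` communicate through `v`. -/
lemma dist_eq_add_of_isBridge {G : SimpleGraph V} (hc : G.Connected) {v b z q : V}
    (hbr : G.IsBridge s(v, b)) (hz : G.dist b z < G.dist v z) (hq : ¬ G.dist b q < G.dist v q) :
    G.dist q z = G.dist q v + G.dist v z := by
  have hbv : b ≠ v := by rintro rfl; omega
  have h1 := reachable_deleteEdges_of_dist_le hc b hbv hz.le
  have h2 := reachable_deleteEdges_of_dist_le hc v hbv.symm (not_lt.1 hq)
  rw [Sym2.eq_swap] at h2
  refine le_antisymm hc.dist_triangle (not_lt.1 fun hlt => ?_)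
  obtain ⟨W, hW⟩ := hc.exists_walk_length_eq_dist q z
  have hv : v ∉ W.support := fun hv => by
    classical
    have h3 := congrArg Walk.length (W.take_spec hv)
    rw [Walk.length_append] at h3
    have := dist_le (W.takeUntil v hv)
    have := dist_le (W.dropUntil v hv)
    omega
  have h3 : (G.deleteEdges {s(v, b)}).Reachable q z :=
    (W.toDeleteEdge s(v, b) fun h => hv (W.fst_mem_support_of_mem_edges h)).reachable
  exact isBridge_iff.1 hbr ((h2.trans h3).trans h1.symm)

/-- Let all links at `v` but those to `y₁` and `y₂` be bridges. If `z` is not closer to `y₁` or `y₂`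
than to `v`, then it hangs at `v`: players beyond `y₁` and `y₂` reach it through `v`. -/
lemma dist_eq_add_of_forall_isBridge {G : SimpleGraph V} (hc : G.Connected) {v y₁ y₂ z q : V}
    (h₁ : G.Adj v y₁) (h₂ : G.Adj v y₂)
    (hbr : ∀ b, G.Adj v b → b ≠ y₁ → b ≠ y₂ → G.IsBridge s(v, b))
    (hz₁ : ¬ G.dist y₁ z < G.dist v z) (hz₂ : ¬ G.dist y₂ z < G.dist v z)
    (hq : G.dist y₁ q < G.dist v q ∨ G.dist y₂ q < G.dist v q) :
    G.dist q z = G.dist q v + G.dist v z := by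
  by_cases hzv : z = v
  · subst hzv; simp
  obtain ⟨b, a, hb⟩ := exists_adj_dist_add_one_eq hc hzv
  rw [dist_comm, dist_comm (u := z)] at hb
  have hb₁ : b ≠ y₁ := by rintro rfl; omega
  have hb₂ : b ≠ y₂ := by rintro rfl; omega
  have hB := hbr b a.symm hb₁ hb₂
  refine dist_eq_add_of_isBridge hc hB (by omega) fun hbq => ?_
  have key : ∀ y, G.Adj v y → b ≠ y → ¬ G.dist y q < G.dist v q := fun y hy hby hyq => by
    have h3 : (G.deleteEdges {s(v, b)}).Adj v y := by
      rw [deleteEdges_adj]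
      refine ⟨hy, ?_⟩
      simp only [Set.mem_singleton_iff, Sym2.eq_iff]
      rintro (⟨-, h⟩ | ⟨h, -⟩)
      exacts [hby h.symm, a.ne h.symm]
    exact isBridge_iff.1 hB (h3.reachable.trans
      ((reachable_deleteEdges_of_dist_le hc b hy.ne' hyq.le).trans
        (reachable_deleteEdges_of_dist_le hc b a.ne hbq.le).symm))
  exact hq.elim (key y₁ h₁ hb₁) (key y₂ h₂ hb₂)

/-! ### Moving a link one step further -/

/-- Shortest paths that avoid `u` survive a deviation of `u`. -/
lemma swapLinks_edist_le_dist {G : SimpleGraph V} (hc : G.Connected) {u p z : V} (B : Finset V)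
    (w : V) (hp : p ≠ u) (h : G.dist p z ≤ G.dist u z) :
    (swapLinks G u B w).edist p z ≤ G.dist p z := by
  obtain ⟨m, hm⟩ : ∃ m, G.dist p z = m := ⟨_, rfl⟩
  induction m using Nat.strong_induction_on generalizing p with
  | _ m ih =>
    by_cases hpz : p = z
    · subst hpz; simp
    obtain ⟨x, a, hx⟩ := exists_adj_dist_add_one_eq hc (Ne.symm hpz)
    rw [dist_comm, dist_comm (u := z)] at hx
    have hxu : x ≠ u := by rintro rfl; omega
    exact (edist_le_add (edist_le_one (swapLinks_adj_of_ne a.symm hp hxu))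
      (ih _ (by omega) hxu (by omega) rfl)).trans (Nat.cast_le.2 (by omega))

/-- The link from `u` to `b` is irrelevant for the distance to `z` if `b` is not closer to `z`. -/
lemma swapLinks_edist_le_dist_self {G : SimpleGraph V} (hc : G.Connected) {u b z : V} (w : V)
    (h : ¬ G.dist b z < G.dist u z) : (swapLinks G u {b} w).edist u z ≤ G.dist u z := by
  by_cases huz : u = z
  · subst huz; simp
  obtain ⟨x, a, hx⟩ := exists_adj_dist_add_one_eq hc (Ne.symm huz)
  rw [dist_comm, dist_comm (u := z)] at hx
  have hxb : x ∉ ({b} : Finset V) := by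
    rw [Finset.mem_singleton]; rintro rfl; omega
  exact (edist_le_add (edist_le_one (swapLinks_adj_of_notMem a.symm hxb))
    (swapLinks_edist_le_dist hc _ _ a.ne (by omega))).trans (Nat.cast_le.2 (by omega))

/-- A bound for the change of the distance from `u` to `z` when `u` exchanges its link to `b` for a
link to a neighbour `w` of `b`. -/
noncomputable def relayShift (G : SimpleGraph V) (u b w z : V) : ℤ :=
  if G.dist b z < G.dist u z then (if G.dist w z < G.dist b z then -1 else 1) else 0

variable [Fintype V] [DecidableEq V]

lemma IsNashEquilibrium.relayShift_sum_nonneg [Nonempty V] {α : ℝ} (hα : 0 ≤ α)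
    {s : StrategyVector V} (hs : IsNashEquilibrium α s) {u b w : V} (hb : b ∈ (s u).1)
    (hbw : (network s).Adj b w) (hw : w ≠ u) : 0 ≤ ∑ z, relayShift (network s) u b w z := by
  have hc := hs.connected
  have hub : (network s).Adj u b := Or.inl hb
  have h := hs.swap_le hα (Finset.singleton_subset_iff.2 hb) hw
    (fun z => ((network s).dist u z + relayShift (network s) u b w z).toNat) fun z => by
      have h1 := dist_le_dist_add_one hc z hub
      have h2 := dist_le_dist_add_one hc z hub.symm
      have h3 := dist_le_dist_add_one hc z hbw
      have h4 := dist_le_dist_add_one hc z hbw.symm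
      simp only [dist_comm (u := z)] at h1 h2 h3 h4
      rw [relayShift]
      split_ifs with hb' hw'
      · exact (edist_le_add (edist_le_one (swapLinks_adj_new hw))
          (swapLinks_edist_le_dist hc _ _ hw (by omega))).trans (Nat.cast_le.2 (by omega))
      · exact (edist_le_add (edist_le_add_one (edist_le_one (swapLinks_adj_new hw))
          (swapLinks_adj_of_ne hbw.symm hw hub.ne'))
          (swapLinks_edist_le_dist hc _ _ hub.ne' (by omega))).trans (Nat.cast_le.2 (by omega))
      · exact (swapLinks_edist_le_dist_self hc w hb').trans (Nat.cast_le.2 (by omega))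
  rw [Finset.card_singleton, Nat.cast_one, mul_one, add_le_add_iff_left, distSum] at h
  have h' : ∑ z, (network s).dist u z
      ≤ ∑ z, ((network s).dist u z + relayShift (network s) u b w z).toNat := by exact_mod_cast h
  have h2 : ((∑ z, ((network s).dist u z + relayShift (network s) u b w z).toNat : ℕ) : ℤ)
      = ∑ z, ((network s).dist u z + relayShift (network s) u b w z) := by
    rw [Nat.cast_sum]
    refine Finset.sum_congr rfl fun z _ => Int.toNat_of_nonneg ?_
    rw [relayShift]
    split_ifs <;> omega
  rw [Finset.sum_add_distrib] at h2
  have h3 : ((∑ z, (network s).dist u z : ℕ) : ℤ) ≤ _ := Int.ofNat_le.2 h'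
  rw [h2, Nat.cast_sum] at h3
  linarith

/-! ### Three consecutive players of degree two -/

omit [Fintype V] [DecidableEq V] in
lemma dropLinks_edist_le {G : SimpleGraph V} (hc : G.Connected) {w x y : V}
    (hx : ReachedBeside G w y x) (hy : ReachedBeside G w x y) (z : V) :
    (dropLinks G x {y}).edist w z ≤ G.dist w z := by
  obtain ⟨m, hm⟩ : ∃ m, G.dist w z = m := ⟨_, rfl⟩
  induction m using Nat.strong_induction_on generalizing z with
  | _ m ih =>
    by_cases hzw : z = w
    · subst hzw; simp
    have key : ∀ p, G.Adj p z → ¬ (p = x ∧ z = y) → ¬ (z = x ∧ p = y) →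
        G.dist w p + 1 = G.dist w z → (dropLinks G x {y}).edist w z ≤ G.dist w z :=
      fun p a h1 h2 hp => hp ▸ edist_le_add_one (ih _ (by omega) p rfl)
        ⟨a, by simpa using h1, by simpa using h2⟩
    obtain ⟨p, a, hp⟩ := exists_adj_dist_add_one_eq hc (Ne.symm hzw)
    by_cases h1 : p = x ∧ z = y
    · obtain ⟨rfl, rfl⟩ := h1
      obtain h | ⟨p', hne, a', hp'⟩ := hy
      · exact absurd h hzw
      · exact key p' a' (fun h => hne h.1) (fun h => a.ne h.1.symm) hp'
    by_cases h2 : z = x ∧ p = y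
    · obtain ⟨rfl, rfl⟩ := h2
      obtain h | ⟨p', hne, a', hp'⟩ := hx
      · exact absurd h hzw
      · exact key p' a' (fun h => a.ne h.2.symm) (fun h => hne h.2) hp'
    exact key p a h1 h2 hp

/-- A link that no shortest path from `w` needs is bought only far from `w`: dropping it, the buyer
`x` can still reach `y` by a detour through `w`. -/
lemma IsNashEquilibrium.nine_le_dist [Nonempty V] {α : ℝ} (hα : 17 * (Fintype.card V : ℝ) < α)
    {s : StrategyVector V} (hs : IsNashEquilibrium α s) {w x y : V} (hxy : y ∈ (s x).1)
    (hx : ReachedBeside (network s) w y x) (hy : ReachedBeside (network s) w x y) :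
    9 ≤ (network s).dist w x := by
  have hc := hs.connected
  have h1 := dropLinks_edist_le hc hx hy x
  have h2 := dropLinks_edist_le hc hx hy y
  rw [edist_comm] at h1
  have h3 := dist_le_dist_add_one hc w (show (network s).Adj x y from Or.inl hxy)
  have h4 := hs.le_of_detour (by linarith [(Fintype.card V).cast_nonneg (α := ℝ)]) hxy
    (L := 2 * (network s).dist w x) ((edist_le_add h1 h2).trans (Nat.cast_le.2 (by omega)))
  have hn : (0 : ℝ) < Fintype.card V := by exact_mod_cast Fintype.card_pos
  by_contra hlt
  have : 2 * (network s).dist w x ≤ 16 := by omega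
  have : ((2 * (network s).dist w x : ℕ) : ℝ) ≤ 16 := by exact_mod_cast this
  nlinarith

/-- Moving a link that no shortest path from `w` needs to `w` is not profitable for its buyer. -/
lemma IsNashEquilibrium.distSum_le_of_reachedBeside [Nonempty V] {α : ℝ} (hα : 0 ≤ α)
    {s : StrategyVector V} (hs : IsNashEquilibrium α s) {w x y : V} (hxy : y ∈ (s x).1)
    (hw : w ≠ x) (hy : ReachedBeside (network s) w x y) :
    distSum (network s) x ≤ ∑ z, (1 + (network s).dist w z) := by
  have h := hs.swap_le hα (Finset.singleton_subset_iff.2 hxy) hw _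
    (swapLinks_edist_le (K := 0) hs.connected hw
      (by rintro b hb; rw [Finset.mem_singleton.1 hb]; exact Or.inl hy))
  rw [Finset.card_singleton, Nat.cast_one, mul_one, add_le_add_iff_left] at h
  exact_mod_cast h

/-- Along `v₀ → v₁ → v₂ → v₃` let `v₂v₃` lie on a cycle, and let all other links at `v₁` and `v₂` be
bridges. The set of the players that `v₀` reaches through `v₃` on a shortest path is left by a
second link. Its buyer `q` is far from `v₀`, could move it to `v₀`, and sees `v₃` before `v₂`. -/
lemma IsNashEquilibrium.exists_far_buyer [Nonempty V] {α : ℝ}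
    (hα : 17 * (Fintype.card V : ℝ) < α) {s : StrategyVector V} (hs : IsNashEquilibrium α s)
    {v₀ v₁ v₂ v₃ : V} (a₀ : (network s).Adj v₀ v₁) (a₁ : (network s).Adj v₁ v₂)
    (a₂ : (network s).Adj v₂ v₃) (hd : (network s).dist v₀ v₃ = 3)
    (hb₁ : ∀ b, (network s).Adj v₁ b → b ≠ v₀ → b ≠ v₂ → (network s).IsBridge s(v₁, b))
    (hb₂ : ∀ b, (network s).Adj v₂ b → b ≠ v₁ → b ≠ v₃ → (network s).IsBridge s(v₂, b))
    (hcyc : ¬ (network s).IsBridge s(v₂, v₃)) :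
    ∃ q, 9 ≤ (network s).dist v₀ q ∧
      distSum (network s) q ≤ ∑ z, (1 + (network s).dist v₀ z) ∧
      (network s).dist v₃ q < (network s).dist v₂ q ∧
      ((network s).dist v₀ q < (network s).dist v₁ q ∨
        (network s).dist v₂ q < (network s).dist v₁ q) := by
  have hc := hs.connected
  have hα0 : 0 ≤ α := by linarith [(Fintype.card V).cast_nonneg (α := ℝ)]
  set G := network s with hG
  have t (x y z : V) : G.dist x z ≤ G.dist x y + G.dist y z := hc.dist_triangle
  have step {x y : V} (a : G.Adj x y) (z : V) : G.dist x z ≤ G.dist y z + 1 := by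
    have := dist_le_dist_add_one hc z a.symm
    rwa [dist_comm, dist_comm (u := z)] at this
  have e₀ := dist_eq_one_iff_adj.2 a₀
  have e₁ := dist_eq_one_iff_adj.2 a₁
  have e₂ := dist_eq_one_iff_adj.2 a₂
  have h02 : G.dist v₀ v₂ = 2 := by
    have := t v₀ v₁ v₂; have := t v₀ v₂ v₃; omega
  -- There is a link other than `v₂v₃` between the set and its complement
  obtain ⟨p, r, apr, hp, hr, hpr⟩ : ∃ p r, G.Adj p r ∧ G.dist v₀ p = 3 + G.dist v₃ p ∧
      G.dist v₀ r ≠ 3 + G.dist v₃ r ∧ ¬ (p = v₃ ∧ r = v₂) := by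
    obtain ⟨W⟩ := not_not.1 (isBridge_iff.not.1 hcyc)
    obtain ⟨e, he, h1, h2⟩ := W.reverse.exists_boundary_dart {z | G.dist v₀ z = 3 + G.dist v₃ z}
      (by simp [hd]) (by simp [h02, dist_comm (u := v₃), e₂])
    have h3 := e.adj
    rw [deleteEdges_adj] at h3
    refine ⟨e.fst, e.snd, h3.1, h1, h2, fun h => h3.2 ?_⟩
    rw [h.1, h.2]
    simp [Sym2.eq_swap]
  have hp2 : G.dist v₃ p < G.dist v₂ p := by have := t v₀ v₂ p; omega
  have hp1 : G.dist v₂ p < G.dist v₁ p := by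
    have := t v₀ v₁ p; have := step a₂ p; omega
  -- Shortest paths from `v₀` need the link `pr` neither to reach `p`, since there is one through
  -- `v₃`, nor to reach `r`, since `r` would then be in the set.
  have bp : ReachedBeside G v₀ r p := by
    by_cases h3 : p = v₃
    · subst h3
      exact Or.inr ⟨v₂, fun h => hpr ⟨rfl, h.symm⟩, a₂, by omega⟩
    · obtain ⟨x, a, hx⟩ := exists_adj_dist_add_one_eq hc (Ne.symm h3)
      have := t v₀ v₃ x
      have := dist_le_dist_add_one hc v₀ a
      exact Or.inr ⟨x, by rintro rfl; omega, a, by omega⟩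
  have br : ReachedBeside G v₀ p r := by
    by_cases h0 : r = v₀
    · exact Or.inl h0
    · obtain ⟨x, a, hx⟩ := exists_adj_dist_add_one_eq hc (Ne.symm h0)
      refine Or.inr ⟨x, ?_, a, hx⟩
      rintro rfl
      have := t v₀ v₃ r
      have := dist_le_dist_add_one hc v₃ a
      omega
  -- The buyer may be inside or outside of the set.
  rcases apr with hbuy | hbuy
  · have h9 := hs.nine_le_dist hα hbuy bp br
    refine ⟨p, h9, hs.distSum_le_of_reachedBeside hα0 hbuy ?_ br, hp2, Or.inr hp1⟩
    rintro rfl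
    simp at h9
  · have h9 := hs.nine_le_dist hα hbuy br bp
    rw [← hG] at h9
    have epr : G.dist p r = 1 := dist_eq_one_iff_adj.2 (Or.inr hbuy)
    have h3r := t v₃ p r
    have h0r := t v₀ r p
    rw [dist_comm (u := r), epr] at h0r
    refine ⟨r, h9, hs.distSum_le_of_reachedBeside hα0 hbuy ?_ bp, ?_, ?_⟩
    · rintro rfl
      simp at h9
    · by_contra h3
      by_cases h1 : G.dist v₁ r < G.dist v₂ r
      · have := step a₀ r
        omega
      · have := dist_eq_add_of_forall_isBridge hc a₁.symm a₂ hb₂ h1 h3 (Or.inr hp2)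
        rw [dist_comm (v := v₂)] at this
        have h5 : G.dist v₂ r = 0 := by omega
        have h6 : G.dist v₃ p = 0 := by omega
        exact hpr ⟨(hc.dist_eq_zero_iff.1 h6).symm, (hc.dist_eq_zero_iff.1 h5).symm⟩
    · by_contra! h
      have := dist_eq_add_of_forall_isBridge hc a₀.symm a₁ hb₁ (not_lt.2 h.1) (not_lt.2 h.2)
        (Or.inr hp1)
      rw [dist_comm (v := v₁)] at this
      omega

/-- In an equilibrium there are no three consecutive players `v₁`, `v₂`, `v₃` of degree two, not
counting bridges, on a directed path `v₀ → v₁ → v₂ → v₃` whose middle is on a cycle.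

The deviations are: each of `v₀`, `v₁`, `v₂` moves its link one step further; `v₂` moves its link to
the far player `q`; `q` moves its link to `v₀`. The sum of the five changes of the distance costs,
with weights `2`, `3`, `1`, `1`, `1`, is nonpositive player by player, and negative for `v₁`. -/
theorem IsNashEquilibrium.not_three_consecutive [Nonempty V] {α : ℝ}
    (hα : 17 * (Fintype.card V : ℝ) < α) {s : StrategyVector V} (hs : IsNashEquilibrium α s)
    {v₀ v₁ v₂ v₃ v₄ : V} (h₀ : v₁ ∈ (s v₀).1) (h₁ : v₂ ∈ (s v₁).1) (h₂ : v₃ ∈ (s v₂).1)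
    (a₃ : (network s).Adj v₃ v₄) (h₂₄ : v₄ ≠ v₂) (hd : (network s).dist v₀ v₃ = 3)
    (hb₁ : ∀ b, (network s).Adj v₁ b → b ≠ v₀ → b ≠ v₂ → (network s).IsBridge s(v₁, b))
    (hb₂ : ∀ b, (network s).Adj v₂ b → b ≠ v₁ → b ≠ v₃ → (network s).IsBridge s(v₂, b))
    (hb₃ : ∀ b, (network s).Adj v₃ b → b ≠ v₂ → b ≠ v₄ → (network s).IsBridge s(v₃, b))
    (hcyc : ¬ (network s).IsBridge s(v₂, v₃)) : False := by
  have hc := hs.connected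
  have hα0 : 0 ≤ α := by linarith [(Fintype.card V).cast_nonneg (α := ℝ)]
  have a₀ : (network s).Adj v₀ v₁ := Or.inl h₀
  have a₁ : (network s).Adj v₁ v₂ := Or.inl h₁
  have a₂ : (network s).Adj v₂ v₃ := Or.inl h₂
  obtain ⟨q, hq0, hqD, hq2, hq1⟩ := hs.exists_far_buyer hα a₀ a₁ a₂ hd hb₁ hb₂ hcyc
  have t (x y z : V) : (network s).dist x z ≤ (network s).dist x y + (network s).dist y z :=
    hc.dist_triangle
  have e₀ := dist_eq_one_iff_adj.2 a₀
  have e₁ := dist_eq_one_iff_adj.2 a₁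
  have e₂ := dist_eq_one_iff_adj.2 a₂
  have e₃ := dist_eq_one_iff_adj.2 a₃
  have h02 : (network s).dist v₀ v₂ = 2 := by
    have := t v₀ v₁ v₂; have := t v₀ v₂ v₃; omega
  have h13 : (network s).dist v₁ v₃ = 2 := by
    have := t v₁ v₂ v₃; have := t v₀ v₁ v₃; omega
  have hqv1 : 8 ≤ (network s).dist q v₁ := by
    have := t v₀ v₁ q; rw [dist_comm]; omega
  have hqv2 : 7 ≤ (network s).dist q v₂ := by
    have := t v₀ v₂ q; rw [dist_comm]; omega
  have hqne : q ≠ v₂ := by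
    rintro rfl
    simp at hqv2
  have hv0 : v₂ ≠ v₀ := by
    rintro rfl
    simp at h02
  have hv1 : v₃ ≠ v₁ := by
    rintro rfl
    simp at h13
  -- `v₂` moves its link to `q`; it keeps its distance to those `z` for which it did not need `v₃`.
  let f : V → ℕ := fun z => if (network s).dist v₃ z < (network s).dist v₂ z then
    1 + (network s).dist q z else min ((network s).dist v₂ z) (1 + (network s).dist q z)
  have hf := hs.swap_le hα0 (Finset.singleton_subset_iff.2 h₂) hqne f fun z => by
    have h1 := swapLinks_edist_le hc hqne (B := {v₃}) (K := 0)
      (by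
        rintro b hb
        rw [Finset.mem_singleton.1 hb]
        exact Or.inl (reachedBeside_of_dist_le hc
          (by rw [dist_comm, dist_comm (u := q)]; exact hq2.le))) z
    simp only [f]
    split_ifs with h
    · exact h1
    · obtain h' | h' := min_choice ((network s).dist v₂ z) (1 + (network s).dist q z) <;> rw [h']
      exacts [swapLinks_edist_le_dist_self hc q h, h1]
  rw [Finset.card_singleton, Nat.cast_one, mul_one, add_le_add_iff_left] at hf
  have hf' : distSum (network s) v₂ ≤ ∑ z, f z := by exact_mod_cast hf
  have r₀ := hs.relayShift_sum_nonneg hα0 h₀ a₁ hv0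
  have r₁ := hs.relayShift_sum_nonneg hα0 h₁ a₂ hv1
  have r₂ := hs.relayShift_sum_nonneg hα0 h₂ a₃ h₂₄
  let g : V → ℤ := fun z => (f z - (network s).dist v₂ z)
    + ((1 + (network s).dist v₀ z : ℕ) - (network s).dist q z)
    + 2 * relayShift (network s) v₀ v₁ v₂ z + 3 * relayShift (network s) v₁ v₂ v₃ z
    + relayShift (network s) v₂ v₃ v₄ z
  have hsum : 0 ≤ ∑ z, g z := by
    simp only [g, Finset.sum_add_distrib, Finset.sum_sub_distrib, ← Finset.mul_sum]
    have h1 : ((distSum (network s) v₂ : ℕ) : ℤ) ≤ ((∑ z, f z : ℕ) : ℤ) := Int.ofNat_le.2 hf'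
    have h2 : ((distSum (network s) q : ℕ) : ℤ)
      ≤ ((∑ z, (1 + (network s).dist v₀ z) : ℕ) : ℤ) := Int.ofNat_le.2 hqD
    simp only [distSum, Nat.cast_sum] at h1 h2
    linarith
  have hpt : ∀ z, g z ≤ 0 ∧ (z = v₁ → g z < 0) := fun z => by
    have hz : z = v₁ → (network s).dist v₁ z = 0 := by
      rintro rfl
      simp
    have st {x y : V} (a : (network s).Adj x y) :
        (network s).dist x z ≤ (network s).dist y z + 1 := by
      have := dist_le_dist_add_one hc z a.symm
      rwa [SimpleGraph.dist_comm, SimpleGraph.dist_comm (u := z)] at this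
    have s₀ := st a₀
    have s₀' := st a₀.symm
    have s₁ := st a₁
    have s₁' := st a₁.symm
    have s₂ := st a₂
    have s₂' := st a₂.symm
    have s₃ := st a₃
    have s₃' := st a₃.symm
    -- For each of `v₁`, `v₂`, `v₃`: if `z` is not beyond one of its two neighbours on the path, then
    -- `z` hangs at it by a bridge, which determines the other distances.
    have w₁ : (network s).dist v₀ z < (network s).dist v₁ z
        ∨ (network s).dist v₂ z < (network s).dist v₁ z
        ∨ (network s).dist v₀ z = 1 + (network s).dist v₁ z
          ∧ (network s).dist v₂ z = 1 + (network s).dist v₁ z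
          ∧ (network s).dist v₃ z = 2 + (network s).dist v₁ z
          ∧ 8 + (network s).dist v₁ z ≤ (network s).dist q z := by
      by_contra! h
      have key := fun x => dist_eq_add_of_forall_isBridge hc (q := x) a₀.symm a₁ hb₁
        (not_lt.2 h.1) (not_lt.2 h.2.1)
      have k0 := key v₀ (Or.inl (by simp [dist_comm (u := v₁), e₀]))
      have k2 := key v₂ (Or.inr (by simp [e₁]))
      have k3 := key v₃ (Or.inr (by simp [h13, e₂]))
      have kq := key q hq1
      rw [e₀] at k0
      rw [dist_comm (v := v₁), e₁] at k2
      rw [dist_comm (v := v₁), h13] at k3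
      have := h.2.2 k0 k2 k3
      omega
    have w₂ : (network s).dist v₁ z < (network s).dist v₂ z
        ∨ (network s).dist v₃ z < (network s).dist v₂ z
        ∨ (network s).dist v₀ z = 2 + (network s).dist v₂ z
          ∧ (network s).dist v₁ z = 1 + (network s).dist v₂ z
          ∧ (network s).dist v₃ z = 1 + (network s).dist v₂ z
          ∧ 7 + (network s).dist v₂ z ≤ (network s).dist q z := by
      by_contra! h
      have key := fun x => dist_eq_add_of_forall_isBridge hc (q := x) a₁.symm a₂ hb₂
        (not_lt.2 h.1) (not_lt.2 h.2.1)
      have k0 := key v₀ (Or.inl (by simp [dist_comm (u := v₁), dist_comm (u := v₂), e₀, h02]))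
      have k1 := key v₁ (Or.inl (by simp [dist_comm (u := v₂), e₁]))
      have k3 := key v₃ (Or.inr (by simp [e₂]))
      have kq := key q (Or.inr hq2)
      rw [h02] at k0
      rw [e₁] at k1
      rw [dist_comm (v := v₂), e₂] at k3
      have := h.2.2 k0 k1 k3
      omega
    have w₃ : (network s).dist v₂ z < (network s).dist v₃ z
        ∨ (network s).dist v₄ z < (network s).dist v₃ z
        ∨ (network s).dist v₀ z = 3 + (network s).dist v₃ z
          ∧ (network s).dist v₁ z = 2 + (network s).dist v₃ z
          ∧ (network s).dist v₂ z = 1 + (network s).dist v₃ z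
          ∧ (network s).dist v₄ z = 1 + (network s).dist v₃ z := by
      by_contra! h
      have key := fun x => dist_eq_add_of_forall_isBridge hc (q := x) a₂.symm a₃ hb₃
        (not_lt.2 h.1) (not_lt.2 h.2.1)
      have k0 := key v₀ (Or.inl (by simp [dist_comm (u := v₂), dist_comm (u := v₃), hd, h02]))
      have k1 := key v₁ (Or.inl (by simp [dist_comm (u := v₂), dist_comm (u := v₃), h13, e₁]))
      have k2 := key v₂ (Or.inl (by simp [dist_comm (u := v₃), e₂]))
      have k4 := key v₄ (Or.inr (by simp [e₃]))
      rw [hd] at k0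
      rw [h13] at k1
      rw [e₂] at k2
      rw [dist_comm (v := v₃), e₃] at k4
      exact h.2.2 k0 k1 k2 k4
    clear hb₁ hb₂ hb₃ hsum hf hf' hqD r₀ r₁ r₂
    simp only [g, f, relayShift]
    generalize (network s).dist v₀ z = d₀ at *
    generalize (network s).dist v₁ z = d₁ at *
    generalize (network s).dist v₂ z = d₂ at *
    generalize (network s).dist v₃ z = d₃ at *
    generalize (network s).dist v₄ z = d₄ at *
    generalize (network s).dist q z = dq at *
    constructor
    · split_ifs <;> omega
    · intro hz'
      have := hz hz'
      split_ifs <;> omega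
  exact absurd (Finset.sum_neg' (fun z _ => (hpt z).1) ⟨v₁, Finset.mem_univ _, (hpt v₁).2 rfl⟩)
    (not_lt.2 hsum)

end

section

variable {V : Type*}

/-! ### Breadth-first search trees -/

/-- `π` is the parent map of a breadth-first search tree of `G` with root `r`; the root is its own
parent. -/
structure IsParentMap (G : SimpleGraph V) (r : V) (π : V → V) : Prop where
  root : π r = r
  adj : ∀ z, z ≠ r → G.Adj (π z) z
  dist : ∀ z, z ≠ r → G.dist r (π z) + 1 = G.dist r z

lemma exists_isParentMap {G : SimpleGraph V} (hc : G.Connected) (r : V) :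
    ∃ π, IsParentMap G r π := by
  classical
  choose! f hf using fun z (hz : r ≠ z) => exists_adj_dist_add_one_eq hc hz
  refine ⟨Function.update f r r, by simp, fun z hz => ?_, fun z hz => ?_⟩ <;>
    rw [Function.update_of_ne hz]
  exacts [(hf z hz.symm).1, (hf z hz.symm).2]

namespace IsParentMap

variable {G : SimpleGraph V} {r : V} {π : V → V}

lemma dist_eq (hπ : IsParentMap G r π) (z : V) : G.dist r (π z) = G.dist r z - 1 := by
  by_cases hz : z = r
  · subst hz; simp [hπ.root]
  · have := hπ.dist z hz; omega

lemma dist_iterate (hπ : IsParentMap G r π) (z : V) (i : ℕ) :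
    G.dist r (π^[i] z) = G.dist r z - i := by
  induction i with
  | zero => simp
  | succ i ih => rw [Function.iterate_succ_apply', hπ.dist_eq, ih]; omega

lemma iterate_dist (hπ : IsParentMap G r π) (hc : G.Connected) (z : V) :
    π^[G.dist r z] z = r := by
  have := hπ.dist_iterate z (G.dist r z)
  rw [Nat.sub_self] at this
  exact (hc.dist_eq_zero_iff.1 this).symm

/-- The tree path from `z` to one of its ancestors, in a graph `K` that contains its edges. -/
lemma edist_iterate_le (hπ : IsParentMap G r π) {K : SimpleGraph V} (z : V) (i : ℕ)
    (hK : ∀ k < i, π^[k] z ≠ r → K.Adj (π (π^[k] z)) (π^[k] z)) :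
    K.edist z (π^[i] z) ≤ ((G.dist r z - G.dist r (π^[i] z) : ℕ) : ℕ∞) := by
  induction i with
  | zero => simp
  | succ i ih =>
    have ih := ih fun k hk => hK k (by omega)
    rw [Function.iterate_succ_apply']
    by_cases hr : π^[i] z = r
    · rw [hr, hπ.root]
      rwa [hr] at ih
    · refine (edist_le_add_one ih (hK i (by omega) hr).symm).trans (Nat.cast_le.2 ?_)
      have := hπ.dist _ hr
      have := hπ.dist_iterate z i
      omega

lemma reachedBeside (hπ : IsParentMap G r π) {u b : V} (h : π b ≠ u) : ReachedBeside G r u b := by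
  by_cases hb : b = r
  · exact Or.inl hb
  · exact Or.inr ⟨π b, h, hπ.adj b hb, hπ.dist b hb⟩

end IsParentMap

/-! ### Links outside the tree -/

/-- `x` buys a link to `y` that is not an edge of the tree with parent map `π`. -/
structure BuysNonTree (s : StrategyVector V) (π : V → V) (x y : V) : Prop where
  mem : y ∈ (s x).1
  fst_ne : π y ≠ x
  snd_ne : π x ≠ y

variable [Fintype V] [DecidableEq V]

/-- If `r` has the least distance cost, no player `u` can replace two links by one link to `r` such
that the distances to the lost neighbours stay within `16` of the route through `r`. -/
lemma IsNashEquilibrium.not_swap_to_center [Nonempty V] {α : ℝ}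
    (hα : 17 * (Fintype.card V : ℝ) < α) {s : StrategyVector V} (hs : IsNashEquilibrium α s)
    {r : V} (hmin : ∀ u, distSum (network s) r ≤ distSum (network s) u) {u b c : V} (hu : r ≠ u)
    (hbc : b ≠ c) (hb : b ∈ (s u).1) (hcu : c ∈ (s u).1)
    (hB : ∀ z ∈ ({b, c} : Finset V), ReachedBeside (network s) r u z ∨
      (swapLinks (network s) u {b, c} r).edist u z
        ≤ ((1 + (network s).dist r z + 16 : ℕ) : ℕ∞)) : False := by
  have hn := (Fintype.card V).cast_nonneg (α := ℝ)
  have h := hs.swap_le (by linarith) (Finset.insert_subset hb (Finset.singleton_subset_iff.2 hcu))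
    hu _ (swapLinks_edist_le hs.connected hu hB)
  have h2 : ∑ z, ((1 + (network s).dist r z + 16 : ℕ) : ℝ)
      = distSum (network s) r + 17 * Fintype.card V := by
    simp [distSum, Finset.sum_add_distrib]
    ring
  have h3 : (distSum (network s) r : ℝ) ≤ distSum (network s) u := by exact_mod_cast hmin u
  rw [Finset.card_pair hbc, h2] at h
  push_cast at h
  linarith

/-- `s` is an equilibrium for the link price `α > 17n`, and `π` is the parent map of a breadth-first
search tree whose root `r` has the least sum of distances. -/
structure CenteredEquilibrium (α : ℝ) (s : StrategyVector V) (r : V) (π : V → V) : Prop where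
  price : 17 * (Fintype.card V : ℝ) < α
  nash : IsNashEquilibrium α s
  parent : IsParentMap (network s) r π
  center : ∀ u, distSum (network s) r ≤ distSum (network s) u

namespace CenteredEquilibrium

variable [Nonempty V] {α : ℝ} {s : StrategyVector V} {r : V} {π : V → V}

/-- A player buys at most one link that is not a link to one of its children. -/
lemma eq_of_parent_ne (h : CenteredEquilibrium α s r π) {u b c : V} (hb : b ∈ (s u).1)
    (hcu : c ∈ (s u).1) (hb' : π b ≠ u) (hc' : π c ≠ u) : b = c := by
  by_contra hbc
  by_cases hu : r = u
  · subst hu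
    have a : (network s).Adj r b := Or.inl hb
    have := h.parent.dist b a.ne'
    rw [dist_eq_one_iff_adj.2 a] at this
    exact hb' (h.nash.connected.dist_eq_zero_iff.1 (by omega)).symm
  refine h.nash.not_swap_to_center h.price h.center hu hbc hb hcu fun z hz => Or.inl ?_
  rw [Finset.mem_insert, Finset.mem_singleton] at hz
  rcases hz with rfl | rfl
  exacts [h.parent.reachedBeside hb', h.parent.reachedBeside hc']

variable {x y : V}

/-- The cycle that a link outside the tree closes with the tree does not turn near its buyer. -/
lemma iterate_ne (h : CenteredEquilibrium α s r π) (hxy : BuysNonTree s π x y) {j : ℕ} (hj : j ≤ 8)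
    (i : ℕ) : π^[i] y ≠ π^[j] x := by
  intro heq
  have hK : ∀ z, z ≠ r → (dropLinks (network s) x {y}).Adj (π z) z := fun z hz =>
    ⟨h.parent.adj z hz, by
      rw [Finset.mem_singleton]; rintro ⟨h1, rfl⟩; exact hxy.fst_ne h1, by
      rw [Finset.mem_singleton]; rintro ⟨rfl, h1⟩; exact hxy.snd_ne h1⟩
  have h1 := h.parent.edist_iterate_le x j fun k _ => hK _
  have h2 := h.parent.edist_iterate_le y i fun k _ => hK _
  rw [edist_comm, heq] at h2
  have h3 := h.parent.dist_iterate x j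
  have h4 := dist_le_dist_add_one h.nash.connected r (show (network s).Adj x y from Or.inl hxy.mem)
  have hn := (Fintype.card V).cast_nonneg (α := ℝ)
  -- Without the link, the common ancestor gives a detour of at most `j + (j + 1) ≤ 17` links.
  have h5 := h.nash.le_of_detour (by linarith [h.price]) hxy.mem (L := 16)
    ((edist_le_add h1 h2).trans (Nat.cast_le.2 (by omega)))
  push_cast at h5
  linarith [h.price]

lemma iterate_ne_root (h : CenteredEquilibrium α s r π) (hxy : BuysNonTree s π x y) {j : ℕ}
    (hj : j ≤ 8) : π^[j] x ≠ r :=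
  fun heq => h.iterate_ne hxy hj _ ((h.parent.iterate_dist h.nash.connected y).trans heq.symm)

lemma eight_lt_dist (h : CenteredEquilibrium α s r π) (hxy : BuysNonTree s π x y) :
    8 < (network s).dist r x := by
  by_contra hlt
  have h1 := h.parent.dist_iterate x 8
  rw [Nat.sub_eq_zero_of_le (not_lt.1 hlt)] at h1
  exact h.iterate_ne_root hxy le_rfl (h.nash.connected.dist_eq_zero_iff.1 h1).symm

/-- If an ancestor `a` of `x` gives up its link to the next player `b` towards `x` for a link to
`r`, it still reaches `b` via `r`, `y` and `x`. -/
lemma edist_swapLinks_iterate_le (h : CenteredEquilibrium α s r π) (hxy : BuysNonTree s π x y)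
    {j : ℕ} (hj : j ≤ 7) (B : Finset V) :
    (swapLinks (network s) (π^[j + 1] x) B r).edist (π^[j + 1] x) (π^[j] x)
      ≤ ((1 + (network s).dist r (π^[j] x) + 16 : ℕ) : ℕ∞) := by
  have hd := h.eight_lt_dist hxy
  have hj1 := h.parent.dist_iterate x (j + 1)
  have hxy1 : (network s).Adj x y := Or.inl hxy.mem
  have hne : ∀ k, k ≤ j → π^[k] x ≠ π^[j + 1] x := fun k hk heq => by
    have := h.parent.dist_iterate x k
    rw [heq] at this
    omega
  have hK : ∀ z, z ≠ r → π z ≠ π^[j + 1] x → z ≠ π^[j + 1] x →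
      (swapLinks (network s) (π^[j + 1] x) B r).Adj (π z) z := fun z hz h1 h2 =>
    swapLinks_adj_of_ne (h.parent.adj z hz) h1 h2
  have h1 := h.parent.edist_iterate_le x j fun k hk hr => hK _ hr
    (by rw [← Function.iterate_succ_apply' π]; exact hne _ hk) (hne k hk.le)
  have h2 := h.parent.edist_iterate_le y ((network s).dist r y) fun k hk hr => hK _ hr
    (by rw [← Function.iterate_succ_apply' π]; exact h.iterate_ne hxy (by omega) _)
    (h.iterate_ne hxy (by omega) k)
  rw [h.parent.iterate_dist h.nash.connected y, SimpleGraph.dist_self, edist_comm] at h2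
  have h3 : (swapLinks (network s) (π^[j + 1] x) B r).Adj y x :=
    swapLinks_adj_of_ne hxy1.symm (h.iterate_ne hxy (by omega) 0) (hne 0 (by omega))
  have h4 := edist_le_one (swapLinks_adj_new (G := network s) (B := B)
    (h.iterate_ne_root hxy (j := j + 1) (by omega)).symm)
  have h5 := dist_le_dist_add_one h.nash.connected r hxy1
  have h6 := h.parent.dist_iterate x j
  -- The route has `1 + d(r, y) + 1 + j` links, and `d(r, y) ≤ d(r, π^[j] x) + j + 1`.
  exact (edist_le_add (edist_le_add_one (edist_le_add h4 h2) h3) h1).trans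
    (Nat.cast_le.2 (by omega))

/-- The links on the tree path that leads to the buyer `x` of a link outside the tree are bought by
the parents, who buy nothing but links to children. -/
lemma chain (h : CenteredEquilibrium α s r π) (hxy : BuysNonTree s π x y) {j : ℕ} (hj : j ≤ 7) :
    π^[j] x ∈ (s (π^[j + 1] x)).1 ∧ ∀ b ∈ (s (π^[j + 1] x)).1, π b = π^[j + 1] x := by
  have hd := h.eight_lt_dist hxy
  -- The parent buys the link as soon as the child does not.
  have up : ∀ i ≤ 7, π^[i + 1] x ∉ (s (π^[i] x)).1 → π^[i] x ∈ (s (π^[i + 1] x)).1 := fun i hi hn => by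
    have a := h.parent.adj _ (h.iterate_ne_root hxy (j := i) (by omega))
    rw [← Function.iterate_succ_apply' π] at a
    exact a.resolve_right hn
  have hne : ∀ i ≤ 7, π (π^[i + 1] x) ≠ π^[i] x := fun i hi heq => by
    have h1 := h.parent.dist_iterate x (i + 2)
    have h2 := h.parent.dist_iterate x i
    rw [Function.iterate_succ_apply' π (i + 1), heq] at h1
    omega
  have only : ∀ i ≤ 7, π^[i] x ∈ (s (π^[i + 1] x)).1 →
      ∀ b ∈ (s (π^[i + 1] x)).1, π b = π^[i + 1] x := fun i hi hmem b hb => by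
    by_contra hbu
    refine h.nash.not_swap_to_center h.price h.center (h.iterate_ne_root hxy (by omega)).symm
      (b := π^[i] x) (c := b) ?_ hmem hb fun z hz => ?_
    · rintro rfl
      exact hbu (Function.iterate_succ_apply' π i x).symm
    · rw [Finset.mem_insert, Finset.mem_singleton] at hz
      rcases hz with rfl | rfl
      exacts [Or.inr (h.edist_swapLinks_iterate_le hxy hi _), Or.inl (h.parent.reachedBeside hbu)]
  have base : ∀ i ≤ 7, π^[i] x ∈ (s (π^[i + 1] x)).1 := fun i => by
    induction i with
    | zero =>
      exact fun hi => up 0 hi fun hmem => hxy.snd_ne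
        (h.eq_of_parent_ne hmem hxy.mem (hne 0 hi) hxy.fst_ne)
    | succ i ih =>
      intro hi
      exact up _ hi fun hmem => hne _ hi (only i (by omega) (ih (by omega)) _ hmem)
  exact ⟨base j hj, only j hj (base j hj)⟩

/-- The tree paths above two buyers of links outside the tree do not meet soon: otherwise the player
at the meeting point could replace the two links that lead to the buyers by one link to `r`. -/
lemma eq_of_iterate_eq (h : CenteredEquilibrium α s r π) (hxy : BuysNonTree s π x y) {x' y' : V}
    (hxy' : BuysNonTree s π x' y') {i j : ℕ} (hi : i ≤ 8) (hj : j ≤ 8)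
    (heq : π^[i] x = π^[j] x') : x = x' := by
  induction i generalizing j with
  | zero =>
    cases j with
    | zero => exact heq
    | succ j =>
      exact absurd ((h.chain hxy' (j := j) (by omega)).2 y (by rw [← heq]; exact hxy.mem))
        (by rw [← heq]; exact hxy.fst_ne)
  | succ i ih =>
    cases j with
    | zero =>
      exact absurd ((h.chain hxy (j := i) (by omega)).2 y' (by rw [heq]; exact hxy'.mem))
        (by rw [heq]; exact hxy'.fst_ne)
    | succ j =>
      by_cases hne : π^[i] x = π^[j] x'
      · exact ih (by omega) (by omega) hne
      refine (h.nash.not_swap_to_center h.price h.center (h.iterate_ne_root hxy hi).symm hne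
        (h.chain hxy (by omega)).1 (by rw [heq]; exact (h.chain hxy' (by omega)).1)
        fun z hz => Or.inr ?_).elim
      rw [Finset.mem_insert, Finset.mem_singleton] at hz
      rcases hz with rfl | rfl
      · exact h.edist_swapLinks_iterate_le hxy (by omega) _
      · rw [heq]
        exact h.edist_swapLinks_iterate_le hxy' (by omega) _

lemma not_isBridge_iterate (h : CenteredEquilibrium α s r π) (hxy : BuysNonTree s π x y)
    {j : ℕ} (hj : j ≤ 7) : ¬ (network s).IsBridge s(π^[j + 1] x, π^[j] x) := by
  have hd := h.eight_lt_dist hxy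
  have hj0 := h.parent.dist_iterate x j
  have hj1 := h.parent.dist_iterate x (j + 1)
  have hxy1 : (network s).Adj x y := Or.inl hxy.mem
  rw [isBridge_iff, not_not]
  set K := (network s).deleteEdges {s(π^[j + 1] x, π^[j] x)} with hK
  have hadj : ∀ p q, (network s).Adj p q → ¬ (p = π^[j + 1] x ∧ q = π^[j] x) →
      ¬ (p = π^[j] x ∧ q = π^[j + 1] x) → K.Adj p q := fun p q a h1 h2 => by
    rw [hK, deleteEdges_adj]
    refine ⟨a, ?_⟩
    simp only [Set.mem_singleton_iff, Sym2.eq_iff]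
    exact fun h => h.elim h1 h2
  have reach : ∀ z i, (∀ k < i, π^[k] z ≠ π^[j + 1] x ∨ π^[k + 1] z ≠ π^[j] x) →
      (∀ k < i, π^[k] z ≠ π^[j] x ∨ π^[k + 1] z ≠ π^[j + 1] x) → K.Reachable z (π^[i] z) :=
    fun z i h1 h2 => by
    have := h.parent.edist_iterate_le (K := K) z i fun k hk hr => by
      refine hadj _ _ (h.parent.adj _ hr) ?_ ?_ <;> rw [← Function.iterate_succ_apply' π]
      · exact fun h3 => (h2 k hk).elim (fun h => h h3.2) fun h => h h3.1
      · exact fun h3 => (h1 k hk).elim (fun h => h h3.2) fun h => h h3.1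
    exact reachable_of_edist_ne_top (ne_top_of_le_ne_top (ENat.natCast_ne_top _) this)
  have hne : ∀ k, π^[k] x = π^[j] x → k = j := fun k heq => by
    have := h.parent.dist_iterate x k
    rw [heq] at this
    omega
  have hne' : ∀ k, π^[k] x = π^[j + 1] x → k = j + 1 := fun k heq => by
    have := h.parent.dist_iterate x k
    rw [heq] at this
    omega
  -- The route leads from `π^[j + 1] x` up to the root, down to `y`, and over `x` to `π^[j] x`
  have r1 : K.Reachable x (π^[j] x) := reach x j (fun k hk => Or.inl fun h3 => by
    have := hne' k h3; omega) (fun k hk => Or.inl fun h3 => by have := hne k h3; omega)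
  have r2 : K.Reachable y r := by
    have := reach y ((network s).dist r y) (fun k _ => Or.inl (h.iterate_ne hxy (by omega) k))
      (fun k _ => Or.inl (h.iterate_ne hxy (by omega) k))
    rwa [h.parent.iterate_dist h.nash.connected y] at this
  have r3 : K.Reachable (π^[j + 1] x) r := by
    have := reach (π^[j + 1] x) ((network s).dist r (π^[j + 1] x))
      (fun k _ => Or.inr fun h3 => by
        rw [← Function.iterate_add_apply] at h3
        have := hne _ h3
        omega)
      (fun k _ => Or.inl fun h3 => by
        rw [← Function.iterate_add_apply] at h3
        have := hne _ h3
        omega)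
    rwa [h.parent.iterate_dist h.nash.connected] at this
  have r4 : K.Adj x y := hadj _ _ hxy1
    (fun h3 => h.iterate_ne hxy (j := j) (by omega) 0 h3.2)
    (fun h3 => h.iterate_ne hxy (j := j + 1) (by omega) 0 h3.2)
  exact ((r3.trans r2.symm).trans r4.reachable.symm).trans r1

/-- Among any three consecutive players on the tree path above `x` there is one with a third link on
a cycle. -/
lemma exists_third_link (h : CenteredEquilibrium α s r π) (hxy : BuysNonTree s π x y)
    {k : ℕ} (hk : k ≤ 3) : ∃ i, k ≤ i ∧ i ≤ k + 2 ∧ ∃ b, (network s).Adj (π^[i + 1] x) b ∧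
      b ≠ π^[i] x ∧ b ≠ π^[i + 2] x ∧ ¬ (network s).IsBridge s(π^[i + 1] x, b) := by
  by_contra! hcon
  have hd := h.eight_lt_dist hxy
  have hc := h.nash.connected
  have hadj : ∀ j ≤ 7, (network s).Adj (π^[j + 1] x) (π^[j] x) := fun j hj =>
    Or.inl (h.chain hxy hj).1
  have e1 := h.parent.dist_iterate x (k + 1)
  have e2 := h.parent.dist_iterate x k
  have e2' := h.parent.dist_iterate x (k + 2)
  have e4 := h.parent.dist_iterate x (k + 4)
  have hd3 : (network s).dist (π^[k + 4] x) (π^[k + 1] x) = 3 := by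
    have t1 := hc.dist_triangle (u := r) (v := π^[k + 4] x) (w := π^[k + 1] x)
    have t2 := dist_le_dist_add_one hc (π^[k + 4] x) (hadj (k + 3) (by omega))
    have t3 := dist_le_dist_add_one hc (π^[k + 4] x) (hadj (k + 2) (by omega))
    have t4 := dist_le_dist_add_one hc (π^[k + 4] x) (hadj (k + 1) (by omega))
    rw [SimpleGraph.dist_self] at t2
    simp only [add_assoc, Nat.reduceAdd] at t2 t3 t4
    omega
  refine h.nash.not_three_consecutive h.price (h.chain hxy (j := k + 3) (by omega)).1
    (h.chain hxy (j := k + 2) (by omega)).1 (h.chain hxy (j := k + 1) (by omega)).1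
    (hadj k (by omega)) ?_ hd3 (fun b a h1 h2 => hcon (k + 2) (by omega) (by omega) b a h2 h1)
    (fun b a h1 h2 => hcon (k + 1) (by omega) (by omega) b a h2 h1)
    (fun b a h1 h2 => hcon k (by omega) (by omega) b a h2 h1)
    (h.not_isBridge_iterate hxy (by omega))
  intro heq
  rw [heq] at e2
  omega

end CenteredEquilibrium

end

section

variable {V : Type*}

/-! ### Counting links on cycles -/

/-- The graph of the links of `G` that lie on cycles. -/
def cycleLinks (G : SimpleGraph V) : SimpleGraph V where
  Adj p q := G.Adj p q ∧ ¬ G.IsBridge s(p, q)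
  symm := ⟨fun _ _ h => ⟨h.1.symm, by rw [Sym2.eq_swap]; exact h.2⟩⟩
  loopless := ⟨fun _ h => G.loopless.irrefl _ h.1⟩

open Classical in
lemma two_le_degree_cycleLinks [Fintype V] {G : SimpleGraph V} {v y : V}
    (h : (cycleLinks G).Adj v y) : 2 ≤ (cycleLinks G).degree v := by
  obtain ⟨u, c, hc, hv⟩ := adj_and_reachable_delete_edges_iff_exists_cycle.1
    ⟨h.1, not_not.1 (isBridge_iff.not.1 h.2)⟩
  rw [← hc.ncard_neighborSet_toSubgraph_eq_two (Walk.fst_mem_support_of_mem_edges c hv),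
    ← card_neighborSet_eq_degree, ← Set.toFinset_card, ← Set.ncard_eq_toFinset_card']
  refine Set.ncard_le_ncard (fun z hz => ?_) (Set.toFinite _)
  have hz' : s(v, z) ∈ c.edges := by
    rw [← Walk.mem_edges_toSubgraph]
    exact hz
  have a : G.Adj v z := c.adj_of_mem_edges hz'
  exact ⟨a, fun hb => (isBridge_iff_forall_cycle_notMem a).1 hb c hc hz'⟩

namespace CenteredEquilibrium

variable [Fintype V] [DecidableEq V] [Nonempty V] {α : ℝ} {s : StrategyVector V} {r : V}
  {π : V → V}

open Classical in
/-- The number of links on cycles is less than the number of players on cycles plus the number of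
buyers of links outside the tree: the remaining ones are links of a forest. -/
lemma card_edgeFinset_lt (h : CenteredEquilibrium α s r π) {p q : V}
    (hpq : (cycleLinks (network s)).Adj p q) :
    (cycleLinks (network s)).edgeFinset.card
      < (Finset.univ.filter fun v => 0 < (cycleLinks (network s)).degree v).card
        + (Finset.univ.filter fun x => ∃ y, BuysNonTree s π x y).card := by
  set H := cycleLinks (network s)
  set S := Finset.univ.filter fun v => 0 < H.degree v
  set X := Finset.univ.filter fun x => ∃ y, BuysNonTree s π x y
  have hS : ∀ {u v}, H.Adj u v → u ∈ S := fun {u v} a => by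
    rw [Finset.mem_filter]
    exact ⟨Finset.mem_univ _, (degree_pos_iff_exists_adj _ _).2 ⟨v, a⟩⟩
  choose! t ht using fun x (hx : x ∈ X) => (Finset.mem_filter.1 hx).2
  -- The parent of the uppermost player `m` on a cycle is not on a cycle.
  obtain ⟨m, hm, hmin⟩ := S.exists_min_image ((network s).dist r) ⟨p, hS hpq⟩
  have hsub : H.edgeFinset ⊆ (S.erase m).image (fun z => s(z, π z)) ∪ X.image fun x => s(x, t x) := by
    have tree : ∀ z, H.Adj z (π z) → s(z, π z) ∈ (S.erase m).image fun z => s(z, π z) :=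
      fun z a => by
      refine Finset.mem_image_of_mem (fun z => s(z, π z))
        (Finset.mem_erase.2 ⟨?_, hS a⟩)
      rintro rfl
      have h1 := hmin _ (hS a.symm)
      have h2 : z ≠ r := by
        rintro rfl
        exact a.ne h.parent.root.symm
      have := h.parent.dist z h2
      omega
    have buy : ∀ x y, H.Adj x y → y ∈ (s x).1 →
        s(x, y) ∈ (S.erase m).image (fun z => s(z, π z)) ∪ X.image fun x => s(x, t x) :=
      fun x y a hy => by
      by_cases h1 : π y = x
      · subst h1
        rw [Sym2.eq_swap]
        exact Finset.mem_union_left _ (tree y a.symm)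
      by_cases h2 : π x = y
      · subst h2
        exact Finset.mem_union_left _ (tree x a)
      have hx : x ∈ X := Finset.mem_filter.2 ⟨Finset.mem_univ _, y, hy, h1, h2⟩
      have : t x = y := h.eq_of_parent_ne (ht x hx).mem hy (ht x hx).fst_ne h1
      exact Finset.mem_union_right _ (Finset.mem_image.2 ⟨x, hx, by rw [this]⟩)
    intro e he
    induction e with
    | _ x y =>
      rw [mem_edgeFinset, mem_edgeSet] at he
      rcases he.1 with hy | hx
      · exact buy x y he hy
      · rw [Sym2.eq_swap]
        exact buy y x he.symm hx
  have h1 := (Finset.card_le_card hsub).trans (Finset.card_union_le _ _)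
  have h2 := Finset.card_image_le (s := S.erase m) (f := fun z => s(z, π z))
  have h3 := Finset.card_image_le (s := X) (f := fun x => s(x, t x))
  have h4 := Finset.card_erase_add_one hm
  omega

open Classical in
/-- There are at least two players of degree at least three for each buyer of a link outside the
tree. -/
lemma two_mul_card_le (h : CenteredEquilibrium α s r π) :
    2 * (Finset.univ.filter fun x => ∃ y, BuysNonTree s π x y).card
      ≤ (Finset.univ.filter fun v => 3 ≤ (cycleLinks (network s)).degree v).card := by
  set H := cycleLinks (network s)
  set X := Finset.univ.filter fun x => ∃ y, BuysNonTree s π x y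
  choose! t ht using fun x (hx : x ∈ X) => (Finset.mem_filter.1 hx).2
  have key : ∀ k ≤ 3, ∀ x ∈ X, ∃ i, k < i ∧ i ≤ k + 3 ∧ 3 ≤ H.degree (π^[i] x) := by
    intro k hk x hx
    obtain ⟨i, hi, hi', b, a, hb1, hb2, hbr⟩ := h.exists_third_link (ht x hx) hk
    refine ⟨i + 1, by omega, by omega, ?_⟩
    have a1 : H.Adj (π^[i + 1] x) (π^[i] x) :=
      ⟨Or.inl (h.chain (ht x hx) (j := i) (by omega)).1,
        h.not_isBridge_iterate (ht x hx) (by omega)⟩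
    have a2 : H.Adj (π^[i + 2] x) (π^[i + 1] x) :=
      ⟨Or.inl (h.chain (ht x hx) (j := i + 1) (by omega)).1,
        h.not_isBridge_iterate (ht x hx) (by omega)⟩
    have hne : π^[i] x ≠ π^[i + 2] x := fun heq => by
      have e1 := h.parent.dist_iterate x i
      have e2 := h.parent.dist_iterate x (i + 2)
      have := h.eight_lt_dist (ht x hx)
      rw [heq] at e1
      omega
    rw [← card_neighborFinset_eq_degree, ← Finset.card_eq_three.2
      ⟨b, π^[i] x, π^[i + 2] x, hb1, hb2, hne, rfl⟩]
    refine Finset.card_le_card fun z hz => ?_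
    rw [mem_neighborFinset]
    simp only [Finset.mem_insert, Finset.mem_singleton] at hz
    rcases hz with rfl | rfl | rfl
    exacts [⟨a, hbr⟩, a1, a2.symm]
  choose! i hi using key 0 (by omega)
  choose! j hj using key 3 (by omega)
  have hinj : ∀ f : V → ℕ, (∀ x ∈ X, f x ≤ 8) → Set.InjOn (fun x => π^[f x] x) X :=
    fun f hf x hx x' hx' heq => h.eq_of_iterate_eq (ht x hx) (ht x' hx') (hf x hx) (hf x' hx') heq
  have h1 := Finset.card_image_of_injOn (hinj i fun x hx => by have := hi x hx; omega)
  have h2 := Finset.card_image_of_injOn (hinj j fun x hx => by have := hj x hx; omega)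
  have hdisj : Disjoint (X.image fun x => π^[i x] x) (X.image fun x => π^[j x] x) := by
    rw [Finset.disjoint_left]
    intro v hv hv'
    obtain ⟨x, hx, rfl⟩ := Finset.mem_image.1 hv
    obtain ⟨x', hx', heq⟩ := Finset.mem_image.1 hv'
    have hix := hi x hx
    have hjx := hj x' hx'
    obtain rfl := h.eq_of_iterate_eq (ht x' hx') (ht x hx) (by omega) (by omega) heq
    have e1 := h.parent.dist_iterate x' (i x')
    have e2 := h.parent.dist_iterate x' (j x')
    have := h.eight_lt_dist (ht x' hx')
    rw [heq] at e2
    omega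
  rw [two_mul]
  nth_rewrite 1 [← h1]
  rw [← h2, ← Finset.card_union_of_disjoint hdisj]
  refine Finset.card_le_card (Finset.union_subset (fun v hv => ?_) fun v hv => ?_)
  · obtain ⟨x, hx, rfl⟩ := Finset.mem_image.1 hv
    exact Finset.mem_filter.2 ⟨Finset.mem_univ _, (hi x hx).2.2⟩
  · obtain ⟨x, hx, rfl⟩ := Finset.mem_image.1 hv
    exact Finset.mem_filter.2 ⟨Finset.mem_univ _, (hj x hx).2.2⟩

lemma isAcyclic (h : CenteredEquilibrium α s r π) : (network s).IsAcyclic := by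
  classical
  rw [isAcyclic_iff_forall_adj_isBridge]
  by_contra! hcon
  obtain ⟨p, q, a, hbr⟩ := hcon
  have h1 := h.card_edgeFinset_lt (p := p) (q := q) ⟨a, hbr⟩
  have h2 := h.two_mul_card_le
  have h3 := (cycleLinks (network s)).sum_degrees_eq_twice_card_edges
  have h4 : ∑ v, ((if 0 < (cycleLinks (network s)).degree v then 2 else 0)
      + if 3 ≤ (cycleLinks (network s)).degree v then 1 else 0)
      ≤ ∑ v, (cycleLinks (network s)).degree v := by
    refine Finset.sum_le_sum fun v _ => ?_
    have : 0 < (cycleLinks (network s)).degree v → 2 ≤ (cycleLinks (network s)).degree v :=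
      fun hv => two_le_degree_cycleLinks ((degree_pos_iff_exists_adj _ _).1 hv).choose_spec
    split_ifs <;> omega
  rw [Finset.sum_add_distrib, ← Finset.sum_filter, ← Finset.sum_filter, Finset.sum_const,
    Finset.sum_const] at h4
  simp only [smul_eq_mul, mul_one] at h4
  omega

end CenteredEquilibrium

end

end NetworkCreation

theorem mainTheorem1 {V : Type*} [Fintype V] [DecidableEq V] [Nonempty V] (α : ℝ)
    (hα : 17 * (Fintype.card V : ℝ) < α) (s : NetworkCreation.StrategyVector V)
    (hs : NetworkCreation.IsNashEquilibrium α s) :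
    (NetworkCreation.network s).IsTree := by
  obtain ⟨r, -, hr⟩ := Finset.univ.exists_min_image
    (NetworkCreation.distSum (NetworkCreation.network s)) Finset.univ_nonempty
  obtain ⟨π, hπ⟩ := NetworkCreation.exists_isParentMap hs.connected r
  exact ⟨hs.connected, NetworkCreation.CenteredEquilibrium.isAcyclic
    ⟨hα, hs, hπ, fun u => hr u (Finset.mem_univ u)⟩⟩
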